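/- Let $\beta,\mathfrak c_5\in\mathbb C$ with $(\beta,\mathfrak c_5)\neq(0,0)$ and consider the quadratic lattice $x(s)=4\beta s^2+\mathfrak c_5 s$. For a polynomial $f\in\mathbb C[z]$ let $\mathrm D_xf$ and $\mathrm S_xf$ be the polynomials determined by $$\mathrm D_xf(x(s))=\frac{f(x(s+\frac12))-f(x(s-\frac12))}{x(s+\frac12)-x(s-\frac12)},\qquad \mathrm S_xf(x(s))=\frac{f(x(s+\frac12))+f(x(s-\frac12))}2 .$$ Let $(P_n)_{n\ge0}$ be a sequence of monic polynomials, $\deg P_n=n$, orthogonal with respect to a linear functional $\mathbf u$ on $\mathbb C[z]$, i.e. $\langle\mathbf u,P_nP_m\rangle=0$ for $n\ne m$ and $\langle\mathbf u,P_n^2\rangle\neq0$; set $P_{-1}=0$, $B_n=\langle\mathbf u,zP_n^2\rangle/\langle\mathbf u,P_n^2\rangle$ and $C_{n+1}=\langle\mathbf u,P_{n+1}^2\rangle/\langle\mathbf u,P_n^2\rangle$. Suppose that there are complex numbers $c$, $b_n$, $c_n$ ($n\ge0$), with $c_n\neq0$ for all $n\ge1$, such that $$(z+c)\,\mathrm D_xP_n(z)=b_n\,\mathrm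 S_xP_n(z)+c_n\,\mathrm S_xP_{n-1}(z),\qquad n=0,1,2,\dots,$$ and $$2\big(C_2+(B_0-B_1)c\big)=(B_1-5\beta)^2-(B_0-5\beta)^2 .$$ For $a,b,c\in\mathbb C$ with $-a-b,\,-a-c,\,-b-c\notin\mathbb N_0=\{0,1,2,\dots\}$, let $H_n(\cdot\,;a,b,c)$ denote the monic continuous dual Hahn polynomials, defined by $H_{-1}=0$, $H_0=1$ and $H_{n+1}(z)=(z-\widetilde B_n)H_n(z)-\widetilde C_nH_{n-1}(z)$, where $\widetilde B_n=(n+a+b)(n+a+c)+n(n+b+c-1)-a^2$ and $\widetilde C_{n+1}=(n+1)(n+a+b)(n+a+c)(n+b+c)$. Then $\beta\neq0$, and there are $a,b\in\mathbb C$ with $-a-b,\,-a-\frac12,\,-b-\frac12\notin\mathbb N_0$ such that $$P_n(z)=(-4\beta)^nH_n\Big(-\frac1{4\beta}\Big(z+\frac{\mathfrak c_5^2}{16\beta}\Big);a,b,\frac12\Big),\qquad n=0,1,2,\dots .$$ Moreover, if $B_0+B_1=2\beta$, then there are $d,e\in\mathbb C$ with $-d,\,-e,\,1-d-e\notin\mathbb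 N_0$ and $$e=-1+\frac1{1+d}\Big(1-\frac{\mathfrak c_5^2}{64\beta^2}\Big),\qquad\text{i.e. } (d+1)(e+1)=1-\frac{\mathfrak c_5^2}{64\beta^2},$$ such that $$P_n(z)=(-4\beta)^nH_n\Big(-\frac1{4\beta}\Big(z+\frac{\mathfrak c_5^2}{16\beta}\Big);d-\frac12,e-\frac12,\frac12\Big),\qquad n=0,1,2,\dots .$$ -/

import Mathlib

open Polynomial

/-- The quadratic lattice `x(s) = 4 β s² + 𝔠₅ s`. -/
def latticeX (β c5 s : ℂ) : ℂ := 4 * β * s ^ 2 + c5 * s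

theorem exists_Dx_Sx (β c5 : ℂ) (f : ℂ[X]) :
    ∃ g h : ℂ[X], ∀ s : ℂ,
      (latticeX β c5 (s + 1 / 2) - latticeX β c5 (s - 1 / 2)) * g.eval (latticeX β c5 s) =
          f.eval (latticeX β c5 (s + 1 / 2)) - f.eval (latticeX β c5 (s - 1 / 2)) ∧
      2 * h.eval (latticeX β c5 s) =
          f.eval (latticeX β c5 (s + 1 / 2)) + f.eval (latticeX β c5 (s - 1 / 2)) := by
  induction f using Polynomial.induction_on with
  | C a =>
    refine ⟨0, C a, fun s => ⟨by simp, ?_⟩⟩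
    simp only [eval_C]; ring
  | add p q hp hq =>
    obtain ⟨g₁, h₁, k₁⟩ := hp
    obtain ⟨g₂, h₂, k₂⟩ := hq
    refine ⟨g₁ + g₂, h₁ + h₂, fun s => ⟨?_, ?_⟩⟩
    · simp only [eval_add]; linear_combination (k₁ s).1 + (k₂ s).1
    · simp only [eval_add]; linear_combination (k₁ s).2 + (k₂ s).2
  | monomial n a ih =>
    obtain ⟨g, h, k⟩ := ih
    refine ⟨h + (X + C β) * g,
      (C (4 * β) * X + C (c5 ^ 2 / 4)) * g + (X + C β) * h, fun s => ?_⟩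
    obtain ⟨k₁, k₂⟩ := k s
    simp only [eval_add, eval_mul, eval_X, eval_C, eval_pow, pow_succ, latticeX] at k₁ k₂ ⊢
    constructor
    · linear_combination (4 * β * s ^ 2 + c5 * s + β) * k₁ + (8 * β * s + c5) / 2 * k₂
    · linear_combination (4 * β * s ^ 2 + c5 * s + β) * k₂ + (8 * β * s + c5) / 2 * k₁

/-- Values on the lattice determine a polynomial. -/
theorem eq_of_eval_latticeX {β c5 : ℂ} (h : (β, c5) ≠ (0, 0)) {p q : ℂ[X]} {S : Set ℂ}
    (hS : S.Finite)
    (hpq : ∀ s ∉ S, p.eval (latticeX β c5 s) = q.eval (latticeX β c5 s)) : p = q := by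
  set L : ℂ[X] := C (4 * β) * X ^ 2 + C c5 * X with hL
  have hLe : ∀ s, L.eval s = latticeX β c5 s := fun s => by simp [hL, latticeX]
  have hcomp : (p - q).comp L = 0 := by
    refine Polynomial.eq_zero_of_infinite_isRoot _ (hS.infinite_compl.mono fun s hs => ?_)
    simp only [Set.mem_ofPred_eq, IsRoot.def, eval_comp, hLe, eval_sub]
    exact sub_eq_zero.2 (hpq s hs)
  rcases Polynomial.comp_eq_zero_iff.1 hcomp with h0 | ⟨-, h1⟩
  · exact sub_eq_zero.1 h0
  · exfalso
    apply h
    have e1 : L.coeff 2 = 0 := by rw [h1]; simp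
    have e2 : L.coeff 1 = 0 := by rw [h1]; simp
    rw [hL, coeff_add, coeff_C_mul_X_pow, coeff_C_mul_X] at e1 e2
    simp at e1 e2
    simp [e1, e2]

/-- The divided difference operator: `Dx f` is the polynomial `g` with
`g(x(s)) = (f(x(s+1/2)) - f(x(s-1/2))) / (x(s+1/2) - x(s-1/2))`. -/
noncomputable def Dx (β c5 : ℂ) (f : ℂ[X]) : ℂ[X] := (exists_Dx_Sx β c5 f).choose

/-- The averaging operator: `Sx f` is the polynomial `h` with
`h(x(s)) = (f(x(s+1/2)) + f(x(s-1/2))) / 2`. -/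
noncomputable def Sx (β c5 : ℂ) (f : ℂ[X]) : ℂ[X] := (exists_Dx_Sx β c5 f).choose_spec.choose

theorem Dx_spec (β c5 : ℂ) (f : ℂ[X]) (s : ℂ) :
    (latticeX β c5 (s + 1 / 2) - latticeX β c5 (s - 1 / 2)) *
        (Dx β c5 f).eval (latticeX β c5 s) =
      f.eval (latticeX β c5 (s + 1 / 2)) - f.eval (latticeX β c5 (s - 1 / 2)) :=
  ((exists_Dx_Sx β c5 f).choose_spec.choose_spec s).1

theorem Sx_spec (β c5 : ℂ) (f : ℂ[X]) (s : ℂ) :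
    2 * (Sx β c5 f).eval (latticeX β c5 s) =
      f.eval (latticeX β c5 (s + 1 / 2)) + f.eval (latticeX β c5 (s - 1 / 2)) :=
  ((exists_Dx_Sx β c5 f).choose_spec.choose_spec s).2

/-- `Dx f` is the only polynomial with its defining property. -/
theorem Dx_unique {β c5 : ℂ} (h : (β, c5) ≠ (0, 0)) (f g : ℂ[X])
    (hg : ∀ s : ℂ, latticeX β c5 (s + 1 / 2) ≠ latticeX β c5 (s - 1 / 2) →
      g.eval (latticeX β c5 s) =
        (f.eval (latticeX β c5 (s + 1 / 2)) - f.eval (latticeX β c5 (s - 1 / 2))) /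
          (latticeX β c5 (s + 1 / 2) - latticeX β c5 (s - 1 / 2))) :
    g = Dx β c5 f := by
  have hd : ∀ s : ℂ, latticeX β c5 (s + 1 / 2) - latticeX β c5 (s - 1 / 2) = 8 * β * s + c5 :=
    fun s => by simp only [latticeX]; ring
  have hS : {s : ℂ | 8 * β * s + c5 = 0}.Finite := by
    refine Set.Subsingleton.finite fun s hs t ht => ?_
    simp only [Set.mem_ofPred_eq] at hs ht
    by_cases hb : β = 0
    · exact absurd (by simpa [hb] using hs) (fun hc : c5 = 0 => h (by simp [hb, hc]))
    · have : 8 * β * (s - t) = 0 := by linear_combination hs - ht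
      simpa [hb, sub_eq_zero] using this
  refine eq_of_eval_latticeX h hS fun s hs => ?_
  have hne : latticeX β c5 (s + 1 / 2) - latticeX β c5 (s - 1 / 2) ≠ 0 := by
    rw [hd]; exact hs
  rw [hg s (sub_ne_zero.1 hne), ← Dx_spec β c5 f s, mul_div_cancel_left₀ _ hne]

/-- `Sx f` is the only polynomial with its defining property. -/
theorem Sx_unique {β c5 : ℂ} (h : (β, c5) ≠ (0, 0)) (f g : ℂ[X])
    (hg : ∀ s : ℂ, g.eval (latticeX β c5 s) =
      (f.eval (latticeX β c5 (s + 1 / 2)) + f.eval (latticeX β c5 (s - 1 / 2))) / 2) :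
    g = Sx β c5 f := by
  refine eq_of_eval_latticeX h Set.finite_empty fun s _ => ?_
  rw [hg s, ← Sx_spec β c5 f s]; ring

/-- `P` is the sequence of monic orthogonal polynomials of the linear functional `u`. -/
structure IsMonicOPS (u : ℂ[X] →ₗ[ℂ] ℂ) (P : ℕ → ℂ[X]) : Prop where
  monic : ∀ n, (P n).Monic
  natDegree_eq : ∀ n, (P n).natDegree = n
  orthogonal : ∀ n m, n ≠ m → u (P n * P m) = 0
  norm_ne_zero : ∀ n, u (P n * P n) ≠ 0

/-- The coefficient `B_n` of `P_{n+1} = (z - B_n) P_n - C_n P_{n-1}`. -/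
noncomputable def recB (u : ℂ[X] →ₗ[ℂ] ℂ) (P : ℕ → ℂ[X]) (n : ℕ) : ℂ :=
  u (X * P n ^ 2) / u (P n ^ 2)

/-- The coefficient `C_n`, `n ≥ 1`, of `P_{n+1} = (z - B_n) P_n - C_n P_{n-1}`
(only its values for `n ≥ 1` are meaningful). -/
noncomputable def recC (u : ℂ[X] →ₗ[ℂ] ℂ) (P : ℕ → ℂ[X]) (n : ℕ) : ℂ :=
  u (P n ^ 2) / u (P (n - 1) ^ 2)

/-- The coefficient `B_n` of the monic continuous dual Hahn polynomials. -/
def dualHahnB (a b c : ℂ) (n : ℕ) : ℂ :=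
  (n + a + b) * (n + a + c) + n * (n + b + c - 1) - a ^ 2

/-- The coefficient `C_{n+1}` of the monic continuous dual Hahn polynomials. -/
def dualHahnCsucc (a b c : ℂ) (n : ℕ) : ℂ :=
  (n + 1) * (n + a + b) * (n + a + c) * (n + b + c)

/-- The monic continuous dual Hahn polynomials `H_n(z; a, b, c)`. -/
noncomputable def dualHahn (a b c : ℂ) : ℕ → ℂ[X]
  | 0 => 1
  | 1 => X - C (dualHahnB a b c 0)
  | n + 2 => (X - C (dualHahnB a b c (n + 1))) * dualHahn a b c (n + 1)
      - C (dualHahnCsucc a b c n) * dualHahn a b c n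

/-- The parameter restriction `-a-b, -a-c, -b-c ∉ ℕ₀`. -/
def DualHahnAdmissible (a b c : ℂ) : Prop :=
  ∀ k : ℕ, -a - b ≠ k ∧ -a - c ≠ k ∧ -b - c ≠ k

/-- The rescaled polynomial
`(-4β)^n H_n(-(1/(4β)) (z + 𝔠₅²/(16β)); a, b, 1/2)`. -/
noncomputable def rescaledDualHahn (β c5 a b : ℂ) (n : ℕ) : ℂ[X] :=
  C ((-4 * β) ^ n) *
    (dualHahn a b (1 / 2) n).comp (C (-(1 / (4 * β))) * (X + C (c5 ^ 2 / (16 * β))))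

/-! Since x(s ± 1/2) = x(s) + β ± (8βs + 𝔠₅)/2, and the square of the half step is 4βx(s) + κ with κ
= 𝔠₅²/4, the three-term recurrence of P turns into coupled recurrences for D_n = Dx P_n and S_n = Sx
P_n. Leading coefficients in the structure relation force b_n = n for n ≥ 1.

The crux is `kappa_eq`: the structure relations for P_2 and P_3, with the condition on C_2, force κ
= 4βc. This gives β ≠ 0 and c = 𝔠₅²/(16β). The factor 4βz + κ is now 4β(z + c), so the structure
relation eliminates the D_n; comparing coefficients in what remains among the S_n gives scalar
recurrences (`coefficient_recurrences`).

These are solved explicitly in `exists_dualHahn_coeff`: C_{n+1}/c_{n+1} is arithmetic in n with step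
-4β, and B_n is quadratic in n. Equal recurrence coefficients give equal polynomials, and C_{n+1} ≠
0 gives the parameter restrictions. -/

/-! ### Orthogonality and the three-term recurrence -/

section OrthogonalPolynomials

variable {u : ℂ[X] →ₗ[ℂ] ℂ} {P : ℕ → ℂ[X]}

theorem IsMonicOPS.coeff_self (hP : IsMonicOPS u P) (n : ℕ) : (P n).coeff n = 1 := by
  have h := hP.monic n
  rwa [Monic, leadingCoeff, hP.natDegree_eq] at h

theorem IsMonicOPS.coeff_of_lt (hP : IsMonicOPS u P) {n k : ℕ} (h : n < k) :
    (P n).coeff k = 0 :=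
  coeff_eq_zero_of_natDegree_lt (by rwa [hP.natDegree_eq])

/-- Subtracting multiples of the monic `P k` from the top down reduces q to 0, and each subtracted
term is orthogonal to `P m`. -/
theorem IsMonicOPS.map_mul_of_coeff_eq_zero (hP : IsMonicOPS u P) (m k : ℕ) (hk : k ≤ m)
    (q : ℂ[X]) (hq : ∀ j, k ≤ j → q.coeff j = 0) : u (q * P m) = 0 := by
  induction k generalizing q with
  | zero =>
    have : q = 0 := by ext j; simpa using hq j (Nat.zero_le _)
    simp [this]
  | succ k ih =>
    have h := ih (by omega) (q - C (q.coeff k) * P k) (by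
      intro j hj
      rcases hj.eq_or_lt with rfl | hj
      · simp [hP.coeff_self]
      · simp [hP.coeff_of_lt hj, hq j hj])
    have h2 : q * P m = (q - C (q.coeff k) * P k) * P m + q.coeff k • (P k * P m) := by
      rw [smul_eq_C_mul]; ring
    rw [h2, map_add, h, map_smul, hP.orthogonal k m (by omega)]
    simp

theorem IsMonicOPS.map_mul (hP : IsMonicOPS u P) (m : ℕ)
    (q : ℂ[X]) (hq : ∀ j, m < j → q.coeff j = 0) :
    u (q * P m) = q.coeff m * u (P m * P m) := by
  have h := hP.map_mul_of_coeff_eq_zero m m le_rfl (q - C (q.coeff m) * P m) (by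
      intro j hj
      rcases hj.eq_or_lt with rfl | hj
      · simp [hP.coeff_self]
      · simp [hP.coeff_of_lt hj, hq j hj])
  have h2 : q * P m = (q - C (q.coeff m) * P m) * P m + q.coeff m • (P m * P m) := by
    rw [smul_eq_C_mul]; ring
  rw [h2, map_add, h, map_smul, zero_add, smul_eq_mul]

/-- A polynomial of degree less than `n` orthogonal to `P 0, …, P (n - 1)` vanishes. -/
theorem IsMonicOPS.eq_zero (hP : IsMonicOPS u P) (n : ℕ) (q : ℂ[X])
    (hq : ∀ j, n ≤ j → q.coeff j = 0) (hu : ∀ k < n, u (q * P k) = 0) : q = 0 := by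
  induction n with
  | zero => ext j; simpa using hq j (Nat.zero_le _)
  | succ n ih =>
    refine ih (fun j hj => ?_) fun k hk => hu k (by omega)
    rcases hj.eq_or_lt with rfl | hj
    · have h := hP.map_mul n q fun j hj => hq j hj
      rw [hu n (by omega)] at h
      exact (mul_eq_zero.1 h.symm).resolve_right (hP.norm_ne_zero n)
    · exact hq j hj

theorem IsMonicOPS.zero_eq (hP : IsMonicOPS u P) : P 0 = 1 :=
  (hP.monic 0).natDegree_eq_zero.1 (hP.natDegree_eq 0)

theorem IsMonicOPS.recB_mul (hP : IsMonicOPS u P) (n : ℕ) :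
    recB u P n * u (P n * P n) = u (X * P n * P n) := by
  rw [recB, pow_two, div_mul_cancel₀ _ (hP.norm_ne_zero n), mul_assoc]

theorem IsMonicOPS.recC_mul (hP : IsMonicOPS u P) (n : ℕ) :
    recC u P (n + 1) * u (P n * P n) = u (P (n + 1) * P (n + 1)) := by
  rw [recC, pow_two, pow_two, Nat.add_sub_cancel, div_mul_cancel₀ _ (hP.norm_ne_zero n)]

theorem IsMonicOPS.recC_ne_zero (hP : IsMonicOPS u P) (n : ℕ) : recC u P (n + 1) ≠ 0 := by
  intro h
  have h1 := hP.recC_mul n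
  rw [h, zero_mul] at h1
  exact hP.norm_ne_zero _ h1.symm

theorem IsMonicOPS.coeff_X_mul_of_lt (hP : IsMonicOPS u P) {n k : ℕ} (h : n + 1 < k) :
    (X * P n).coeff k = 0 := by
  obtain ⟨k, rfl⟩ : ∃ j, k = j + 1 := ⟨k - 1, by omega⟩
  rw [coeff_X_mul]
  exact hP.coeff_of_lt (by omega)

theorem IsMonicOPS.one_eq (hP : IsMonicOPS u P) : P 1 = X - C (recB u P 0) := by
  refine sub_eq_zero.1 (hP.eq_zero 1 _ (fun j hj => ?_) fun k hk => ?_)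
  · rcases hj.eq_or_lt with rfl | hj
    · simp [hP.coeff_self]
    · simp [hP.coeff_of_lt hj, coeff_C, coeff_X, show j ≠ 0 by omega, show 1 ≠ j by omega]
  · obtain rfl : k = 0 := by omega
    have h := hP.recB_mul 0
    have e : (P 1 - (X - C (recB u P 0))) * P 0
        = P 1 * P 0 - X * P 0 * P 0 + recB u P 0 • (P 0 * P 0) := by
      rw [smul_eq_C_mul, hP.zero_eq]; ring
    rw [e, map_add, map_sub, map_smul, hP.orthogonal 1 0 (by norm_num), smul_eq_mul, h]
    ring

/-- The difference of the two sides has degree below n + 2 and is orthogonal to every `P k` with k <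
n + 2, so it vanishes. -/
theorem IsMonicOPS.three_term (hP : IsMonicOPS u P) (n : ℕ) :
    P (n + 2) = (X - C (recB u P (n + 1))) * P (n + 1) - C (recC u P (n + 1)) * P n := by
  refine sub_eq_zero.1 (hP.eq_zero (n + 2) _ (fun j hj => ?_) fun k hk => ?_)
  · rw [sub_mul]
    rcases hj.eq_or_lt with rfl | hj
    · simp [hP.coeff_self, hP.coeff_of_lt]
    · simp [hP.coeff_of_lt hj, hP.coeff_X_mul_of_lt hj, hP.coeff_of_lt (show n + 1 < j by omega),
        hP.coeff_of_lt (show n < j by omega)]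
  · have e : (P (n + 2) - ((X - C (recB u P (n + 1))) * P (n + 1) - C (recC u P (n + 1)) * P n))
          * P k
        = P (n + 2) * P k - X * P k * P (n + 1) + recB u P (n + 1) • (P (n + 1) * P k)
          + recC u P (n + 1) • (P n * P k) := by
      simp only [smul_eq_C_mul]; ring
    rw [e, map_add, map_add, map_sub, map_smul, map_smul, smul_eq_mul, smul_eq_mul,
      hP.orthogonal (n + 2) k (by omega)]
    rcases Nat.lt_succ_iff_lt_or_eq.1 hk with hk | rfl
    · rcases Nat.lt_succ_iff_lt_or_eq.1 hk with hk | rfl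
      · rw [hP.orthogonal (n + 1) k (by omega), hP.orthogonal n k (by omega),
          hP.map_mul_of_coeff_eq_zero (n + 1) (n + 1) le_rfl (X * P k)
            fun j hj => hP.coeff_X_mul_of_lt (by omega)]
        ring
      · rw [hP.orthogonal (k + 1) k (by omega), hP.recC_mul,
          hP.map_mul (k + 1) (X * P k) fun j hj => hP.coeff_X_mul_of_lt hj, coeff_X_mul,
          hP.coeff_self]
        ring
    · rw [hP.orthogonal n (n + 1) (by omega), hP.recB_mul]
      ring

end OrthogonalPolynomials

/-! ### Product rules for the lattice operators -/

section LatticeOperators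

variable {β c5 : ℂ}

theorem finite_latticeX_step_eq_zero (h : (β, c5) ≠ (0, 0)) :
    {s : ℂ | 8 * β * s + c5 = 0}.Finite := by
  refine Set.Subsingleton.finite fun s hs t ht => ?_
  simp only [Set.mem_ofPred_eq] at hs ht
  by_cases hb : β = 0
  · exact absurd (by simpa [hb] using hs) (fun hc : c5 = 0 => h (by simp [hb, hc]))
  · have : 8 * β * (s - t) = 0 := by linear_combination hs - ht
    simpa [hb, sub_eq_zero] using this

theorem Dx_eq_of_mul (h : (β, c5) ≠ (0, 0)) {f g : ℂ[X]}
    (hg : ∀ s : ℂ, (8 * β * s + c5) * g.eval (latticeX β c5 s) =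
      f.eval (latticeX β c5 (s + 1 / 2)) - f.eval (latticeX β c5 (s - 1 / 2))) :
    Dx β c5 f = g := by
  refine eq_of_eval_latticeX h (finite_latticeX_step_eq_zero h) fun s hs => ?_
  refine mul_left_cancel₀ (a := 8 * β * s + c5) hs ?_
  rw [hg s, ← Dx_spec β c5 f s]
  simp only [latticeX]; ring

theorem Sx_eq_of_mul (h : (β, c5) ≠ (0, 0)) {f g : ℂ[X]}
    (hg : ∀ s : ℂ, 2 * g.eval (latticeX β c5 s) =
      f.eval (latticeX β c5 (s + 1 / 2)) + f.eval (latticeX β c5 (s - 1 / 2))) :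
    Sx β c5 f = g := by
  refine eq_of_eval_latticeX h Set.finite_empty fun s _ => ?_
  refine mul_left_cancel₀ (a := (2 : ℂ)) two_ne_zero ?_
  rw [hg s, ← Sx_spec β c5 f s]

theorem Dx_spec' (β c5 : ℂ) (f : ℂ[X]) (s : ℂ) :
    (8 * β * s + c5) * (Dx β c5 f).eval (latticeX β c5 s) =
      f.eval (latticeX β c5 (s + 1 / 2)) - f.eval (latticeX β c5 (s - 1 / 2)) := by
  rw [← Dx_spec β c5 f s]
  simp only [latticeX]; ring

theorem Dx_one (h : (β, c5) ≠ (0, 0)) : Dx β c5 1 = 0 :=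
  Dx_eq_of_mul h fun s => by simp

theorem Sx_one (h : (β, c5) ≠ (0, 0)) : Sx β c5 1 = 1 :=
  Sx_eq_of_mul h fun s => by simp only [eval_one]; norm_num

/-- The action of `Dx` on the right-hand side of a three-term recurrence. -/
theorem Dx_three_term (h : (β, c5) ≠ (0, 0)) (a b : ℂ) (f g : ℂ[X]) :
    Dx β c5 ((X - C a) * f - C b * g) =
      Sx β c5 f + (X + C β - C a) * Dx β c5 f - C b * Dx β c5 g := by
  refine Dx_eq_of_mul h fun s => ?_
  have k₁ := Dx_spec' β c5 f s
  have k₂ := Sx_spec β c5 f s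
  have k₃ := Dx_spec' β c5 g s
  simp only [eval_add, eval_sub, eval_mul, eval_X, eval_C]
  simp only [latticeX] at k₁ k₂ k₃ ⊢
  linear_combination (4 * β * s ^ 2 + c5 * s + β - a) * k₁ + (8 * β * s + c5) / 2 * k₂ - b * k₃

/-- The action of `Sx` on the right-hand side of a three-term recurrence. -/
theorem Sx_three_term (h : (β, c5) ≠ (0, 0)) (a b : ℂ) (f g : ℂ[X]) :
    Sx β c5 ((X - C a) * f - C b * g) =
      (C (4 * β) * X + C (c5 ^ 2 / 4)) * Dx β c5 f + (X + C β - C a) * Sx β c5 f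
        - C b * Sx β c5 g := by
  refine Sx_eq_of_mul h fun s => ?_
  have k₁ := Dx_spec' β c5 f s
  have k₂ := Sx_spec β c5 f s
  have k₃ := Sx_spec β c5 g s
  simp only [eval_add, eval_sub, eval_mul, eval_X, eval_C]
  simp only [latticeX] at k₁ k₂ k₃ ⊢
  linear_combination (4 * β * s ^ 2 + c5 * s + β - a) * k₂ + (8 * β * s + c5) / 2 * k₁ - b * k₃

end LatticeOperators

/-! ### Consequences of the structure relation -/

/-- The recurrences satisfied by `D n = Dx (P n)` and `S n = Sx (P n)`, where `P` obeys a
three-term recurrence with coefficients `B n` and `G n` (the latter being `C_{n+1}`), and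
`κ` is the constant term of `(x(s + 1/2) - x(s - 1/2))² / 4` as a polynomial in `x(s)`. -/
structure LatticeRecurrence (β κ : ℂ) (B G : ℕ → ℂ) (D S : ℕ → ℂ[X]) : Prop where
  D_zero : D 0 = 0
  S_zero : S 0 = 1
  D_one : D 1 = 1
  S_one : S 1 = X + C β - C (B 0)
  D_add_two : ∀ n, D (n + 2) = S (n + 1) + (X + C β - C (B (n + 1))) * D (n + 1) - C (G n) * D n
  S_add_two : ∀ n, S (n + 2) = (C (4 * β) * X + C κ) * D (n + 1)
    + (X + C β - C (B (n + 1))) * S (n + 1) - C (G n) * S n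

theorem IsMonicOPS.latticeRecurrence {u : ℂ[X] →ₗ[ℂ] ℂ} {P : ℕ → ℂ[X]} (hP : IsMonicOPS u P)
    {β c5 : ℂ} (h : (β, c5) ≠ (0, 0)) :
    LatticeRecurrence β (c5 ^ 2 / 4) (recB u P) (fun n => recC u P (n + 1))
      (fun n => Dx β c5 (P n)) (fun n => Sx β c5 (P n)) := by
  have e : P 1 = (X - C (recB u P 0)) * 1 - C 0 * 1 := by rw [hP.one_eq]; simp
  constructor
  · simp only [hP.zero_eq, Dx_one h]
  · simp only [hP.zero_eq, Sx_one h]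
  · simp only [e]
    rw [Dx_three_term h, Dx_one h, Sx_one h]; simp
  · simp only [e]
    rw [Sx_three_term h, Dx_one h, Sx_one h]; simp
  · intro n
    simp only [hP.three_term n]
    exact Dx_three_term h _ _ _ _
  · intro n
    simp only [hP.three_term n]
    exact Sx_three_term h _ _ _ _

namespace LatticeRecurrence

variable {β κ : ℂ} {B G : ℕ → ℂ} {D S : ℕ → ℂ[X]}

/-- The recurrences reach back two steps and couple D with S, so degrees and leading coefficients at
two consecutive indices are carried through one induction. -/
theorem coeff_aux (h : LatticeRecurrence β κ B G D S) (n : ℕ) :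
    ((∀ k, n < k → (S n).coeff k = 0) ∧ (S n).coeff n = 1 ∧ (∀ k, n ≤ k → (D n).coeff k = 0)) ∧
    ((∀ k, n + 1 < k → (S (n + 1)).coeff k = 0) ∧ (S (n + 1)).coeff (n + 1) = 1 ∧
      (∀ k, n + 1 ≤ k → (D (n + 1)).coeff k = 0)) ∧ (D (n + 1)).coeff n = n + 1 := by
  induction n with
  | zero =>
    refine ⟨⟨fun k hk => ?_, ?_, fun k _ => ?_⟩, ⟨fun k hk => ?_, ?_, fun k hk => ?_⟩, ?_⟩
    · simp [h.S_zero, coeff_one, show k ≠ 0 by omega]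
    · simp [h.S_zero]
    · simp [h.D_zero]
    · simp [h.S_one, coeff_X, coeff_C, show k ≠ 0 by omega, show 1 ≠ k by omega]
    · simp [h.S_one]
    · simp [h.D_one, coeff_one, show k ≠ 0 by omega]
    · simp [h.D_one]
  | succ n ih =>
    obtain ⟨⟨s1, s2, s3⟩, ⟨t1, t2, t3⟩, t4⟩ := ih
    have hX : ∀ (f : ℂ[X]) (k : ℕ), 0 < k → (X * f).coeff k = f.coeff (k - 1) := by
      intro f k hk
      obtain ⟨j, rfl⟩ : ∃ j, k = j + 1 := ⟨k - 1, by omega⟩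
      simp [coeff_X_mul]
    have hD : ∀ k, 0 < k → (D (n + 2)).coeff k = (S (n + 1)).coeff k + ((D (n + 1)).coeff (k - 1)
        + (β - B (n + 1)) * (D (n + 1)).coeff k) - G n * (D n).coeff k := by
      intro k hk
      have e : D (n + 2) = S (n + 1) + (X * D (n + 1) + C (β - B (n + 1)) * D (n + 1))
          - C (G n) * D n := by rw [h.D_add_two, C_sub]; ring
      rw [e]
      simp only [coeff_add, coeff_sub, coeff_C_mul, hX _ k hk]
    have hS : ∀ k, 0 < k → (S (n + 2)).coeff k = 4 * β * (D (n + 1)).coeff (k - 1)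
        + κ * (D (n + 1)).coeff k + ((S (n + 1)).coeff (k - 1)
        + (β - B (n + 1)) * (S (n + 1)).coeff k) - G n * (S n).coeff k := by
      intro k hk
      have e : S (n + 2) = C (4 * β) * (X * D (n + 1)) + C κ * D (n + 1)
          + (X * S (n + 1) + C (β - B (n + 1)) * S (n + 1))
          - C (G n) * S n := by rw [h.S_add_two, C_sub]; ring
      rw [e]
      simp only [coeff_add, coeff_sub, coeff_C_mul, hX _ k hk]
    refine ⟨⟨t1, t2, t3⟩, ⟨fun k hk => ?_, ?_, fun k hk => ?_⟩, ?_⟩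
    · rw [hS k (by omega), t3 (k - 1) (by omega), t3 k (by omega), t1 (k - 1) (by omega),
        t1 k (by omega), s1 k (by omega)]
      ring
    · rw [hS _ (by omega), t3 _ (by omega), t3 _ (by omega), t1 (n + 1 + 1) (by omega),
        s1 _ (by omega), Nat.add_sub_cancel, t2]
      ring
    · rw [hD k (by omega), t3 (k - 1) (by omega), t3 k (by omega), t1 k (by omega),
        s3 k (by omega)]
      ring
    · rw [hD _ (by omega), t3 (n + 1) (by omega), Nat.add_sub_cancel, t4, t2, s3 _ (by omega)]
      push_cast; ring

theorem coeff_S_self (h : LatticeRecurrence β κ B G D S) (n : ℕ) : (S n).coeff n = 1 :=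
  (h.coeff_aux n).1.2.1

theorem coeff_S_of_lt (h : LatticeRecurrence β κ B G D S) {n k : ℕ} (hk : n < k) :
    (S n).coeff k = 0 :=
  (h.coeff_aux n).1.1 k hk

theorem coeff_D_self (h : LatticeRecurrence β κ B G D S) (n : ℕ) : (D n).coeff n = 0 :=
  (h.coeff_aux n).1.2.2 n le_rfl

theorem coeff_D_succ (h : LatticeRecurrence β κ B G D S) (n : ℕ) :
    (D (n + 1)).coeff n = n + 1 :=
  (h.coeff_aux n).2.2

/-- The leading coefficient of the structure relation. -/
theorem structure_coeff_eq (h : LatticeRecurrence β κ B G D S) {c b g : ℂ} {n : ℕ}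
    (hrel : (X + C c) * D (n + 1) = C b * S (n + 1) + C g * S n) : b = n + 1 := by
  have e := congrArg (fun f : ℂ[X] => f.coeff (n + 1)) hrel
  simpa [add_mul, h.coeff_D_self, h.coeff_D_succ, h.coeff_S_self,
    h.coeff_S_of_lt (Nat.lt_succ_self n)] using e.symm

/-- As `S (m + 1)` and `S m` are monic of degrees m + 1 and m, the coefficients at m + 2, m + 1 and
m isolate k, e and f in turn. -/
theorem eq_zero_of_linear_mul_S (h : LatticeRecurrence β κ B G D S) {k e f : ℂ} {m : ℕ}
    (hz : (C k * X + C e) * S (m + 1) + C f * S m = 0) : k = 0 ∧ e = 0 ∧ f = 0 := by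
  have hk : k = 0 := by
    have e1 := congrArg (fun q : ℂ[X] => q.coeff (m + 2)) hz
    simpa [add_mul, mul_assoc, coeff_X_mul, h.coeff_S_self, h.coeff_S_of_lt] using e1
  have he : e = 0 := by
    have e1 := congrArg (fun q : ℂ[X] => q.coeff (m + 1)) hz
    simpa [hk, h.coeff_S_self, h.coeff_S_of_lt] using e1
  refine ⟨hk, he, ?_⟩
  have e1 := congrArg (fun q : ℂ[X] => q.coeff m) hz
  simpa [hk, he, h.coeff_S_self] using e1

theorem coeff_eq_zero_of_forall_cubic {a₀ a₁ a₂ a₃ : ℂ}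
    (h : ∀ y : ℂ, a₃ * y ^ 3 + a₂ * y ^ 2 + a₁ * y + a₀ = 0) :
    a₀ = 0 ∧ a₁ = 0 ∧ a₂ = 0 := by
  have h0 := h 0
  have h1 := h 1
  have h2 := h (-1)
  have h3 := h 2
  refine ⟨by linear_combination h0, ?_, by linear_combination h1 / 2 + h2 / 2 - h0⟩
  linear_combination h1 - h2 / 3 - h3 / 6 - h0 / 2

theorem structure_coeff_zero (h : LatticeRecurrence β κ B G D S) {c g : ℂ}
    (hrel : (X + C c) * D 1 = C ((0 : ℂ) + 1) * S 1 + C g * S 0) : g = c + B 0 - β := by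
  have e := congrArg (eval 0) hrel
  simp [h.D_one, h.S_one, h.S_zero] at e
  linear_combination -e

/-- The first structure relations and the constraint on `C_2` force `U₂(-c) = 0`. -/
theorem kappa_eq (h : LatticeRecurrence β κ B G D S) {c : ℂ} {g : ℕ → ℂ}
    (hg : ∀ n, g n ≠ 0) (hG : ∀ n, G n ≠ 0)
    (hrel : ∀ n : ℕ, (X + C c) * D (n + 1) = C ((n : ℂ) + 1) * S (n + 1) + C (g n) * S n)
    (hc : 2 * (G 1 + (B 0 - B 1) * c) = (B 1 - 5 * β) ^ 2 - (B 0 - 5 * β) ^ 2) :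
    κ = 4 * β * c := by
  have hD2 := h.D_add_two 0
  have hS2 := h.S_add_two 0
  have hD3 := h.D_add_two 1
  have hS3 := h.S_add_two 1
  simp only [zero_add, Nat.reduceAdd] at hD2 hS2 hD3 hS3
  have r1 := hrel 1
  have r2 := hrel 2
  simp only [Nat.reduceAdd] at r1 r2
  rw [hD3, hS3, hD2, hS2, h.D_zero, h.D_one, h.S_zero, h.S_one] at r2
  rw [hD2, hS2, h.D_zero, h.D_one, h.S_zero, h.S_one] at r1
  -- In the variable y = z + c, with B and κ shifted accordingly, c drops out of all equations; `hc`
  -- becomes 2 C_2 = (q - p)(p + q - 10β), and the goal becomes K = 0.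
  have e1 : ∀ y : ℂ, _ := fun y => congrArg (eval (y - c)) r1
  have e2 : ∀ y : ℂ, _ := fun y => congrArg (eval (y - c)) r2
  simp only [eval_add, eval_sub, eval_mul, eval_X, eval_C, eval_one, eval_zero, Nat.cast_one,
    Nat.cast_ofNat] at e1 e2
  obtain ⟨p, hp⟩ : ∃ p, B 0 = p - c := ⟨B 0 + c, by ring⟩
  obtain ⟨q, hq⟩ : ∃ q, B 1 = q - c := ⟨B 1 + c, by ring⟩
  obtain ⟨r, hr⟩ : ∃ r, B 2 = r - c := ⟨B 2 + c, by ring⟩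
  obtain ⟨K, rfl⟩ : ∃ K, κ = K + 4 * β * c := ⟨κ - 4 * β * c, by ring⟩
  have hg1 := hg 1
  have hG1 := hG 1
  rw [hp, hq] at hc e1
  rw [hp, hq, hr] at e2
  generalize g 1 = g1 at *
  generalize g 2 = g2 at *
  generalize G 0 = G0 at *
  generalize G 1 = G1 at *
  obtain ⟨a0, a1, -⟩ := coeff_eq_zero_of_forall_cubic (a₃ := 0) (a₂ := 0)
    (a₁ := g1 - (p + q - 10 * β))
    (a₀ := 2 * (β ^ 2 + K - (p + q) * β + p * q - G0) + g1 * (β - p))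
    fun y => by linear_combination -e1 y
  obtain ⟨b0, b1, b2⟩ := coeff_eq_zero_of_forall_cubic (a₃ := 0)
    (a₂ := g2 - (p + q + r - 35 * β))
    (a₁ := 42 * β ^ 2 + 8 * K - 16 * (p + q + r) * β
      + 2 * (p * q - G0 + r * (p + q) - G1) + g2 * (6 * β - (p + q)))
    (a₀ := 3 * (β ^ 3 + 3 * K * β - (p + q + r) * (β ^ 2 + K)
      + (p * q - G0 + r * (p + q) - G1) * β - (r * (p * q - G0) - G1 * p))
      + g2 * (β ^ 2 + K - (p + q) * β + p * q - G0))
    fun y => by linear_combination -e2 y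
  clear e1 e2 r1 r2
  -- Here w is the defect of B_0, B_1, B_2 from having second difference -16β, the value in the dual
  -- Hahn case. The equations give K as a multiple of w, and finally w C_2 = 0.
  obtain ⟨w, rfl⟩ : ∃ w, r = 2 * q - p - 16 * β + w := ⟨r - (2 * q - p - 16 * β), by ring⟩
  obtain rfl : g1 = p + q - 10 * β := by linear_combination a1
  obtain rfl : g2 = p + q + (2 * q - p - 16 * β + w) - 35 * β := by linear_combination b2
  obtain rfl : G1 = (q - p) * (p + q - 10 * β) / 2 := by linear_combination hc / 2
  obtain rfl : G0 = (2 * (β ^ 2 + K - (p + q) * β + p * q) + (p + q - 10 * β) * (β - p)) / 2 := by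
    linear_combination -a0 / 2
  obtain rfl : K = -(p + q - 10 * β) * w / 6 := by linear_combination b1 / 6
  have hw : w * ((q - p) * (p + q - 10 * β) / 2) = 0 := by linear_combination b0
  rw [(mul_eq_zero.1 hw).resolve_right hG1]
  ring

theorem S_add_two_of_structure (h : LatticeRecurrence β κ B G D S) {c : ℂ} {g : ℕ → ℂ}
    (hκ : κ = 4 * β * c)
    (hrel : ∀ n : ℕ, (X + C c) * D (n + 1) = C ((n : ℂ) + 1) * S (n + 1) + C (g n) * S n)
    (n : ℕ) : S (n + 2) = (C (4 * β * (n + 1) + β - B (n + 1)) + X) * S (n + 1)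
      + C (4 * β * g n - G n) * S n := by
  have e := h.S_add_two n
  have r := hrel n
  simp only [hκ, C_add, C_sub, C_mul] at e r ⊢
  linear_combination e + C 4 * C β * r

/-- Multiply the recurrence for `D (n + 2)` by X + c and apply the structure relations at n and n +
1. The term in `D n` is kept, as no relation in `hrel` covers `D 0`. -/
theorem structure_combination (h : LatticeRecurrence β κ B G D S) {c : ℂ} {g : ℕ → ℂ}
    (hκ : κ = 4 * β * c)
    (hrel : ∀ n : ℕ, (X + C c) * D (n + 1) = C ((n : ℂ) + 1) * S (n + 1) + C (g n) * S n)
    (n : ℕ) :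
    C (4 * β * (n + 1) * (n + 2) + β - B (n + 1) - c + g (n + 1)) * S (n + 1) =
      (C (g n) * (X + C (β - B (n + 1))) - C ((n + 2) * (4 * β * g n - G n))) * S n
        - C (G n) * ((X + C c) * D n) := by
  have e1 := h.S_add_two_of_structure hκ hrel n
  have e2 := h.D_add_two n
  have r0 := hrel n
  have r1 := hrel (n + 1)
  have e3 : (C 2 : ℂ[X]) = C 1 + 1 := by rw [← C_1, ← C_add]; norm_num
  push_cast at r1
  simp only [C_add, C_sub, C_mul, e3, C_1] at e1 e2 r0 r1 ⊢
  linear_combination (X + C c) * e2 - r1 - (C (n : ℂ) + 1 + 1) * e1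
    + (X + C β - C (B (n + 1))) * r0

/-- The recurrences for the coefficients implied by the structure relations when
`U₂(z) = 4β(z + c)`. -/
theorem coefficient_recurrences (h : LatticeRecurrence β κ B G D S) {c : ℂ} {g : ℕ → ℂ}
    (hκ : κ = 4 * β * c)
    (hrel : ∀ n : ℕ, (X + C c) * D (n + 1) = C ((n : ℂ) + 1) * S (n + 1) + C (g n) * S n)
    (n : ℕ) :
    g (n + 1) = g n + B (n + 1) + c - β - 4 * β * (n + 1) * (n + 2) ∧
    2 * G n = g n * (B (n + 1) - B n + 8 * β * (n + 1)) ∧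
    ∀ m, n = m + 1 → G n * g m = g n * (G m - 4 * β * g m) := by
  have e := h.structure_combination hκ hrel n
  -- For n = 0 the leftover term vanishes because `D 0 = 0`; otherwise the structure relation at m
  -- rewrites it through `S (m + 1)` and `S m`.
  rcases n with _ | m
  · rw [zero_add, h.D_zero, h.S_zero, h.S_one] at e
    have e0 := congrArg (coeff · 0) e
    have e1 := congrArg (coeff · 1) e
    simp [coeff_C, coeff_X, sub_mul, add_mul, mul_sub, mul_add] at e0 e1
    have k1 : g 1 = g 0 + B 1 + c - β - 8 * β := by linear_combination e1
    refine ⟨by push_cast; linear_combination k1, ?_, by omega⟩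
    rw [zero_add]
    push_cast
    linear_combination (β - B 0) * k1 - e0
  · have e1 := h.S_add_two_of_structure hκ hrel m
    rw [hrel m, e1] at e
    have hz : (C (4 * β * ((m + 1 : ℕ) + 1) * ((m + 1 : ℕ) + 2) + β - B (m + 2) - c + g (m + 2)
          - g (m + 1)) * X + C ((4 * β * ((m + 1 : ℕ) + 1) * ((m + 1 : ℕ) + 2) + β - B (m + 2)
          - c + g (m + 2)) * (4 * β * (m + 1) + β - B (m + 1)) - g (m + 1) * (β - B (m + 2))
          + ((m + 1 : ℕ) + 2) * (4 * β * g (m + 1) - G (m + 1)) + G (m + 1) * (m + 1)))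
          * S (m + 1) + C ((4 * β * ((m + 1 : ℕ) + 1) * ((m + 1 : ℕ) + 2) + β - B (m + 2) - c
          + g (m + 2)) * (4 * β * g m - G m) + G (m + 1) * g m) * S m = 0 := by
      simp only [C_add, C_sub, C_mul] at e ⊢
      linear_combination e
    obtain ⟨k0, k1, k2⟩ := h.eq_zero_of_linear_mul_S hz
    push_cast at k0 k1 k2 ⊢
    refine ⟨by linear_combination k0, ?_, ?_⟩
    · linear_combination (4 * β * (m + 1) + β - B (m + 1)) * k0 - k1
    · rintro _ ⟨⟩
      linear_combination k2 - (4 * β * g m - G m) * k0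

end LatticeRecurrence

/-! ### Solving the recurrences -/

/-- The coefficient recurrences have a solution of continuous dual Hahn type. -/
theorem exists_dualHahn_coeff {β c : ℂ} (hβ : β ≠ 0) {B G g : ℕ → ℂ} (hg : ∀ n, g n ≠ 0)
    (h0 : g 0 = c + B 0 - β)
    (h1 : ∀ n, g (n + 1) = g n + B (n + 1) + c - β - 4 * β * (n + 1) * (n + 2))
    (h2 : ∀ n, 2 * G n = g n * (B (n + 1) - B n + 8 * β * (n + 1)))
    (h3 : ∀ n, G (n + 1) * g n = g (n + 1) * (G n - 4 * β * g n)) :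
    ∃ a b : ℂ, ∀ n : ℕ,
      g n = -4 * β * (n + 1) * (n + a + 1 / 2) * (n + b + 1 / 2) ∧
      G n = (-4 * β) ^ 2 * dualHahnCsucc a b (1 / 2) n ∧
      B n = -4 * β * dualHahnB a b (1 / 2) n - c := by
  -- σ and π play the roles of a + b and ab, fitted to `G 0` and `B 0`; a is then a root of t² - σt
  -- + π.
  obtain ⟨σ, hσ⟩ : ∃ σ, G 0 = g 0 * (-4 * β * σ) :=
    ⟨G 0 / g 0 / (-4 * β), by field_simp [hg 0]⟩
  obtain ⟨π, hπ⟩ : ∃ π, B 0 = -4 * β * (π + σ / 2) - c :=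
    ⟨(B 0 + c) / (-4 * β) - σ / 2, by field_simp; ring⟩
  obtain ⟨a, ha⟩ : ∃ a, a ^ 2 - σ * a + π = 0 := by
    obtain ⟨t, ht⟩ := IsAlgClosed.exists_pow_nat_eq (σ ^ 2 / 4 - π) (n := 2) (by norm_num)
    exact ⟨t + σ / 2, by linear_combination ht⟩
  refine ⟨a, σ - a, ?_⟩
  obtain rfl : π = a * (σ - a) := by linear_combination ha
  -- The induction carries the quotient of `G n` by `g n`, because `h3` makes it arithmetic with
  -- step -4β.
  suffices H : ∀ n : ℕ,
      g n = -4 * β * (n + 1) * (n + a + 1 / 2) * (n + (σ - a) + 1 / 2) ∧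
      G n = g n * (-4 * β * (σ + n)) ∧
      B n = -4 * β * dualHahnB a (σ - a) (1 / 2) n - c by
    intro n
    obtain ⟨k1, k2, k3⟩ := H n
    refine ⟨k1, ?_, k3⟩
    rw [k2, k1, dualHahnCsucc]
    ring
  intro n
  induction n with
  | zero =>
    refine ⟨?_, by rw [hσ]; push_cast; ring, ?_⟩
    · rw [h0, hπ]; push_cast; ring
    · rw [hπ, dualHahnB]; push_cast; ring
  | succ n ih =>
    obtain ⟨k1, k2, k3⟩ := ih
    have kB : B (n + 1) = -4 * β * dualHahnB a (σ - a) (1 / 2) (n + 1) - c := by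
      have e : B (n + 1) = B n - 8 * β * (n + 1) + 2 * (-4 * β * (σ + n)) :=
        mul_left_cancel₀ (hg n) (by linear_combination 2 * k2 - h2 n)
      rw [e, k3, dualHahnB, dualHahnB]
      push_cast; ring
    refine ⟨?_, ?_, kB⟩
    · rw [h1, k1, kB, dualHahnB]
      push_cast; ring
    · refine mul_right_cancel₀ (hg n) ?_
      push_cast
      linear_combination h3 n + g (n + 1) * k2

/-! ### Identification with the rescaled dual Hahn polynomials -/

section RescaledDualHahn

variable {β : ℂ} (c5 a b : ℂ)

theorem rescaledDualHahn_zero : rescaledDualHahn β c5 a b 0 = 1 := by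
  simp [rescaledDualHahn, dualHahn]

theorem rescaledDualHahn_one (hβ : β ≠ 0) : rescaledDualHahn β c5 a b 1 =
    X - C (-4 * β * dualHahnB a b (1 / 2) 0 - c5 ^ 2 / (16 * β)) := by
  refine Polynomial.funext fun z => ?_
  simp only [rescaledDualHahn, dualHahn, eval_mul, eval_comp, eval_sub, eval_add, eval_X, eval_C]
  field_simp
  ring

theorem rescaledDualHahn_add_two (hβ : β ≠ 0) (n : ℕ) : rescaledDualHahn β c5 a b (n + 2) =
    (X - C (-4 * β * dualHahnB a b (1 / 2) (n + 1) - c5 ^ 2 / (16 * β)))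
        * rescaledDualHahn β c5 a b (n + 1)
      - C ((-4 * β) ^ 2 * dualHahnCsucc a b (1 / 2) n) * rescaledDualHahn β c5 a b n := by
  refine Polynomial.funext fun z => ?_
  simp only [rescaledDualHahn, dualHahn, eval_mul, eval_comp, eval_sub, eval_add, eval_X, eval_C]
  generalize eval _ (dualHahn a b (1 / 2) n) = v
  generalize eval _ (dualHahn a b (1 / 2) (n + 1)) = w
  generalize dualHahnB a b (1 / 2) (n + 1) = r
  generalize dualHahnCsucc a b (1 / 2) n = t
  field_simp
  ring

end RescaledDualHahn

theorem IsMonicOPS.eq_rescaledDualHahn {u : ℂ[X] →ₗ[ℂ] ℂ} {P : ℕ → ℂ[X]} (hP : IsMonicOPS u P)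
    {β c5 a b : ℂ} (hβ : β ≠ 0)
    (hB : ∀ n, recB u P n = -4 * β * dualHahnB a b (1 / 2) n - c5 ^ 2 / (16 * β))
    (hC : ∀ n, recC u P (n + 1) = (-4 * β) ^ 2 * dualHahnCsucc a b (1 / 2) n) (n : ℕ) :
    P n = rescaledDualHahn β c5 a b n := by
  suffices H : P n = rescaledDualHahn β c5 a b n ∧
      P (n + 1) = rescaledDualHahn β c5 a b (n + 1) from H.1
  induction n with
  | zero =>
    rw [hP.zero_eq, rescaledDualHahn_zero, zero_add, hP.one_eq, rescaledDualHahn_one _ _ _ hβ, hB]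
    exact ⟨rfl, rfl⟩
  | succ n ih =>
    refine ⟨ih.2, ?_⟩
    rw [hP.three_term, rescaledDualHahn_add_two _ _ _ hβ, ih.1, ih.2, hB, hC]

/-- If one of the three quantities equals k ∈ ℕ₀, a factor of the coefficient with index k vanishes.
-/
theorem dualHahnAdmissible_of_ne_zero {a b : ℂ}
    (h : ∀ n : ℕ, dualHahnCsucc a b (1 / 2) n ≠ 0) : DualHahnAdmissible a b (1 / 2) := by
  refine fun k => ⟨fun e => h k ?_, fun e => h k ?_, fun e => h k ?_⟩ <;>
    rw [dualHahnCsucc, ← e] <;> ring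

theorem mainTheorem4 (β c5 : ℂ) (hlat : (β, c5) ≠ (0, 0))
    (u : ℂ[X] →ₗ[ℂ] ℂ) (P : ℕ → ℂ[X]) (hP : IsMonicOPS u P)
    (c : ℂ) (bn cn : ℕ → ℂ)
    (hcn : ∀ n : ℕ, 1 ≤ n → cn n ≠ 0)
    (hrel : ∀ n : ℕ, (X + C c) * Dx β c5 (P n) =
      C (bn n) * Sx β c5 (P n) + C (cn n) * Sx β c5 (if n = 0 then 0 else P (n - 1)))
    (hc : 2 * (recC u P 2 + (recB u P 0 - recB u P 1) * c) =
      (recB u P 1 - 5 * β) ^ 2 - (recB u P 0 - 5 * β) ^ 2) :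
    β ≠ 0 ∧
    (∃ a b : ℂ, DualHahnAdmissible a b (1 / 2) ∧
      ∀ n : ℕ, P n = rescaledDualHahn β c5 a b n) ∧
    (recB u P 0 + recB u P 1 = 2 * β →
      ∃ d e : ℂ, (∀ k : ℕ, -d ≠ k) ∧
        e = -1 + 1 / (1 + d) * (1 - c5 ^ 2 / (64 * β ^ 2)) ∧
        DualHahnAdmissible (d - 1 / 2) (e - 1 / 2) (1 / 2) ∧
        ∀ n : ℕ, P n = rescaledDualHahn β c5 (d - 1 / 2) (e - 1 / 2) n) := by
  have hL := hP.latticeRecurrence hlat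
  have hg : ∀ n, cn (n + 1) ≠ 0 := fun n => hcn (n + 1) (by omega)
  have hrel' : ∀ n : ℕ, (X + C c) * Dx β c5 (P (n + 1)) =
      C ((n : ℂ) + 1) * Sx β c5 (P (n + 1)) + C (cn (n + 1)) * Sx β c5 (P n) := by
    intro n
    have e := hrel (n + 1)
    rw [if_neg (by omega), Nat.add_sub_cancel] at e
    rwa [hL.structure_coeff_eq e] at e
  have hκ : c5 ^ 2 / 4 = 4 * β * c :=
    hL.kappa_eq (g := fun n => cn (n + 1)) hg hP.recC_ne_zero hrel' hc
  have hβ : β ≠ 0 := by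
    rintro rfl
    exact hlat (by simpa using hκ)
  obtain rfl : c = c5 ^ 2 / (16 * β) := by
    field_simp
    linear_combination -4 * hκ
  have hR := hL.coefficient_recurrences (g := fun n => cn (n + 1)) hκ hrel'
  have h0 : cn 1 = _ := hL.structure_coeff_zero (by simpa using hrel' 0)
  obtain ⟨a, b, hab⟩ := exists_dualHahn_coeff (g := fun n => cn (n + 1)) hβ hg h0
    (fun n => (hR n).1) (fun n => (hR n).2.1) (fun n => (hR (n + 1)).2.2 n rfl)
  have hadm : DualHahnAdmissible a b (1 / 2) := dualHahnAdmissible_of_ne_zero fun n hn =>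
    hP.recC_ne_zero n (by rw [(hab n).2.1, hn, mul_zero])
  have hPn := hP.eq_rescaledDualHahn hβ (fun n => (hab n).2.2) (fun n => (hab n).2.1)
  refine ⟨hβ, ⟨a, b, hadm, hPn⟩, fun hs => ?_⟩
  have hd : ∀ k : ℕ, -(a + 1 / 2) ≠ k := fun k hk => (hadm k).2.1 (by rw [← hk]; ring)
  -- With d = a + 1/2 and e = b + 1/2, admissibility of (a, b, 1/2) says that -d, -e and 1 - d - e
  -- avoid ℕ₀.
  refine ⟨a + 1 / 2, b + 1 / 2, hd, ?_, by simpa using hadm, by simpa using hPn⟩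
  have hd1 : 1 + (a + 1 / 2) ≠ 0 := fun e => hd 1 (by push_cast; linear_combination -e)
  rw [(hab 0).2.2, (hab 1).2.2, dualHahnB, dualHahnB] at hs
  -- Inserting the explicit B_0 and B_1 turns B_0 + B_1 = 2β into this product formula.
  have key : (1 + (a + 1 / 2)) * (1 + (b + 1 / 2)) = 1 - c5 ^ 2 / (64 * β ^ 2) := by
    have hs' : β * (2 * a * b + 3 * (a + b) + 2) * 4 + 2 * (c5 ^ 2 / (16 * β)) + 2 * β = 0 := by
      push_cast at hs
      linear_combination -hs
    field_simp at hs' ⊢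
    linear_combination 2 * hs'
  rw [← key, one_div_mul_eq_div, mul_div_cancel_left₀ _ hd1]
  ring
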